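/- For real $\alpha > 1$ let $\mathrm{PS}(\alpha) = \{\lfloor n^\alpha \rfloor : n \in \mathbb{N}\}$, where $\mathbb{N}$ is the set of positive integers. For real $a, b$ and a set $S \subseteq \mathbb{N}$, call the equation $y = ax + b$ solvable in $S$ if there are infinitely many distinct pairs $(x,y) \in S \times S$ satisfying it, and unsolvable in $S$ otherwise. Theorem. Let $a, b \in \mathbb{R}$ with $a \neq 0$, and suppose that the equation $y = ax + b$ is solvable in $\mathbb{N}$. Then for Lebesgue-almost every $\alpha > 1$ the following hold: (i) if $\alpha < 2$ and $0 \leq b < a$, then $y = ax + b$ is solvable in $\mathrm{PS}(\alpha)$; (ii) if $\alpha > 2$ and $(a,b) \neq (1,0)$, then $y = ax + b$ is unsolvable in $\mathrm{PS}(\alpha)$. -/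

import Mathlib

/-- The image `PS(α)` of the Piatetski-Shapiro sequence `n ↦ ⌊n ^ α⌋`, `n` a positive integer. -/
noncomputable def PS (α : ℝ) : Set ℕ :=
  {m : ℕ | ∃ n : ℕ, 0 < n ∧ m = ⌊(n : ℝ) ^ α⌋₊}

/-- The equation `y = a x + b` is solvable in `S`: infinitely many distinct pairs
`(x, y) ∈ S × S` satisfy it. "Unsolvable" is the negation. -/
def SolvableIn (a b : ℝ) (S : Set ℕ) : Prop :=
  {p : ℕ × ℕ | p.1 ∈ S ∧ p.2 ∈ S ∧ (p.2 : ℝ) = a * (p.1 : ℝ) + b}.Infinite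

open MeasureTheory Filter Topology

/-!
Solvability in the positive integers forces `a > 0` and provides a progression of `x` along which
`a * x + b` is a natural number. If `x = ⌊n ^ α⌋` and `y = ⌊m ^ α⌋` solve the equation, then
`m ^ α` is within `O(1)` of `a * n ^ α`, that is, `m / n` is within `O(n ^ (-α))` of
`θ = a ^ α⁻¹`. The critical exponent `2` is the exponent of Diophantine approximation of almost
every real number.

For `α > 2` infinitely many solutions would make `θ` approximable to an exponent above `2`
(`liouvilleWith_of_solvableIn_PS`). Such `θ` form a null set, and so do the corresponding `α`,
since `α ↦ a ^ α⁻¹` has a differentiable inverse (`ae_rpow_inv_notMem`); rational `θ` are discarded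
likewise. The case `a = 1`, where `θ = 1`, is handled by the irrationality of well-approximable
numbers.

For `α < 2` let `m / n` be a Dirichlet approximation of `θ₀ = a ^ α₀⁻¹`, with error `1 / n ^ 2`. For
`α` in a window of width about `1 / (n ^ α₀ * log n)` next to `α₀` the difference
`m ^ α - a * n ^ α` stays close to `0`, while `n ^ α` moves by a bounded amount that can be chosen
to exceed the common difference of the progression. So a fixed proportion of the window consists of
`α` for which `n ^ α` has integer part in the progression and fractional part in the range where
`m ^ α ≈ a * n ^ α` implies `⌊m ^ α⌋ = a * ⌊n ^ α⌋ + b`; this range is nonempty as `0 ≤ b < a`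
(`exists_closedBall_forall_solution`). Hence no `α₀` is a density point of the set of exponents that
admit no solution with `x ≥ k`, and by Lebesgue's density theorem that set is null for every `k`
(`ae_notMem_of_forall_exists_closedBall_disjoint`).
-/

/-! ### Solutions in the positive integers -/

theorem injOn_fst_solutions (a b : ℝ) (S : Set ℕ) :
    Set.InjOn Prod.fst {p : ℕ × ℕ | p.1 ∈ S ∧ p.2 ∈ S ∧ (p.2 : ℝ) = a * (p.1 : ℝ) + b} := by
  rintro ⟨x, y⟩ ⟨-, -, h⟩ ⟨x', y'⟩ ⟨-, -, h'⟩ (rfl : x = x')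
  have : (y : ℝ) = y' := by simp only at h h'; rw [h, h']
  simpa using this

/-- Infinitely many solutions in positive integers force `a > 0`; and two of them, `(x₀, y₀)` and
`(x₁, y₁)`, make `a * x + b` a natural number for every `x` in the progression
`x₀ + (x₁ - x₀) * t`. -/
theorem solvableIn_progression {a b : ℝ} (ha : a ≠ 0) (hab : SolvableIn a b {n : ℕ | 0 < n}) :
    0 < a ∧ ∃ x₀ q : ℕ, 0 < q ∧ ∀ t : ℕ, ∃ y : ℕ, (y : ℝ) = a * ((x₀ + q * t : ℕ) : ℝ) + b := by
  have hinf := Set.Infinite.image (injOn_fst_solutions a b _) hab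
  have hpos : 0 < a := by
    by_contra hneg
    have hneg : a < 0 := lt_of_le_of_ne (not_lt.1 hneg) ha
    obtain ⟨N, hN⟩ := exists_nat_gt (b / (-a))
    obtain ⟨x, ⟨⟨x', y⟩, ⟨-, -, h⟩, rfl⟩, hx⟩ := hinf.exists_gt N
    simp only at h hx
    have h1 : (N : ℝ) < x' := by exact_mod_cast hx
    have h2 : (0 : ℝ) ≤ y := by positivity
    rw [div_lt_iff₀ (by linarith)] at hN
    nlinarith
  refine ⟨hpos, ?_⟩
  obtain ⟨_, ⟨⟨x₀, y₀⟩, ⟨-, -, h₀⟩, rfl⟩⟩ := hinf.nonempty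
  obtain ⟨_, ⟨⟨x₁, y₁⟩, ⟨-, -, h₁⟩, rfl⟩, hx⟩ := hinf.exists_gt x₀
  simp only at h₀ h₁ hx
  have hx' : (x₀ : ℝ) < x₁ := by exact_mod_cast hx
  have hy : y₀ ≤ y₁ := by
    have : (y₀ : ℝ) ≤ y₁ := by nlinarith
    exact_mod_cast this
  refine ⟨x₀, x₁ - x₀, by omega, fun t => ⟨y₀ + (y₁ - y₀) * t, ?_⟩⟩
  push_cast [Nat.cast_sub hy, Nat.cast_sub hx.le]
  linear_combination h₀ + t * (h₁ - h₀)

/-! ### Dirichlet approximation -/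

/-- Dirichlet's theorem with arbitrarily large denominators; the fraction need not be reduced, which
is what makes the statement true for rational `θ`. -/
theorem exists_ge_abs_sub_div_le (θ : ℝ) (N : ℕ) :
    ∃ n : ℕ, N ≤ n ∧ ∃ m : ℤ, |θ - m / n| ≤ 1 / (n : ℝ) ^ 2 := by
  by_cases hθ : Irrational θ
  · have hlim := (tendsto_one_div_add_atTop_nhds_zero_nat (𝕜 := ℝ)).const_mul 2
    rw [mul_zero] at hlim
    obtain ⟨M, hM, hM0⟩ := ((hlim.eventually
      (hθ.eventually_forall_le_dist_cast_rat_of_den_le N)).and (eventually_gt_atTop 0)).exists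
    obtain ⟨r, hr, hrM⟩ := Real.exists_rat_abs_sub_le_and_den_le θ hM0
    have hd : (0 : ℝ) < r.den := by exact_mod_cast r.den_pos
    have hM' : (r.den : ℝ) ≤ M := by exact_mod_cast hrM
    have hle : |θ - r| ≤ 1 / (r.den : ℝ) ^ 2 := by
      refine hr.trans (one_div_le_one_div_of_le (by positivity) ?_)
      nlinarith
    refine ⟨r.den, ?_, r.num, by rwa [← Rat.cast_def]⟩
    by_contra hlt
    push Not at hlt
    -- A denominator below `N` forces distance at least `2 / (M + 1)`, but the distance is at most
    -- `1 / (M + 1)`.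
    have hfar := hM r hlt.le
    rw [Real.dist_eq] at hfar
    have hd1 : (1 : ℝ) ≤ r.den := by exact_mod_cast r.den_pos
    have hpos : (0 : ℝ) < 1 / ((M : ℝ) + 1) := by positivity
    have hclose : 1 / (((M : ℝ) + 1) * r.den) ≤ 1 / ((M : ℝ) + 1) :=
      one_div_le_one_div_of_le (by positivity) (by nlinarith)
    linarith
  · obtain ⟨r, rfl⟩ : ∃ r : ℚ, (r : ℝ) = θ := by simpa [Irrational] using hθ
    refine ⟨r.den * (N + 1), ?_, r.num * (N + 1), ?_⟩
    · nlinarith [r.den_pos]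
    · have hd : (r.den : ℝ) ≠ 0 := by exact_mod_cast r.den_pos.ne'
      have hN : (N : ℝ) + 1 ≠ 0 := by positivity
      have : (r : ℝ) - ((r.num * (N + 1) : ℤ) : ℝ) / ((r.den * (N + 1) : ℕ) : ℝ) = 0 := by
        push_cast
        rw [mul_div_mul_right _ _ hN, ← Rat.cast_def, sub_self]
      rw [this, abs_zero]
      positivity

/-! ### Unsolvability for exponents above two -/

theorem abs_sub_mul_rpow_le {u v α : ℝ} (hu : 0 ≤ u) (hv : 0 < v) (hα : 1 ≤ α) :
    |u - v| * v ^ (α - 1) ≤ |u ^ α - v ^ α| := by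
  have hsplit : ∀ w : ℝ, 0 ≤ w → w ^ α = w * w ^ (α - 1) := by
    intro w hw
    rcases hw.eq_or_lt with rfl | hw
    · rw [Real.zero_rpow (by linarith), zero_mul]
    · rw [Real.rpow_sub_one hw.ne']; field_simp
  rw [hsplit u hu, hsplit v hv.le]
  rcases le_total v u with h | h
  · have h1 := Real.rpow_le_rpow hv.le h (by linarith : 0 ≤ α - 1)
    rw [abs_of_nonneg (by linarith)]
    refine le_trans ?_ (le_abs_self _)
    nlinarith
  · have h1 := Real.rpow_le_rpow hu h (by linarith : 0 ≤ α - 1)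
    rw [abs_of_nonpos (by linarith)]
    refine le_trans ?_ (neg_le_abs _)
    nlinarith

/-- A solution `⌊m ^ α⌋ = a * ⌊n ^ α⌋ + b` says that `m ^ α` is within a bounded distance of
`a * n ^ α = (θ * n) ^ α`, where `θ = a ^ α⁻¹`, so that `|θ - m / n| = O(n ^ (-α))`. The
hypothesis `hne` excludes exact equality, which `LiouvilleWith` does not count. -/
theorem liouvilleWith_of_solvableIn_PS {a b α : ℝ} (ha : 0 < a) (hα : 1 < α)
    (hS : SolvableIn a b (PS α))
    (hne : ∀ n m : ℕ, 0 < n → (⌊(m : ℝ) ^ α⌋₊ : ℝ) = a * ⌊(n : ℝ) ^ α⌋₊ + b →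
      a ^ α⁻¹ ≠ (m : ℝ) / n) :
    LiouvilleWith α (a ^ α⁻¹) := by
  set θ := a ^ α⁻¹ with hθ
  have hθ0 : 0 < θ := Real.rpow_pos_of_pos ha _
  have hθα : θ ^ α = a := by
    rw [hθ, ← Real.rpow_mul ha.le, inv_mul_cancel₀ (by linarith), Real.rpow_one]
  refine ⟨(a + 1) / θ ^ (α - 1) + |b| / θ ^ (α - 1) + 1, frequently_atTop.2 fun N => ?_⟩
  obtain ⟨_, ⟨⟨x, y⟩, ⟨⟨n, hn, hx⟩, ⟨m, hm, hy⟩, h⟩, rfl⟩, hlt⟩ :=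
    (Set.Infinite.image (injOn_fst_solutions a b _) hS).exists_gt ⌊(N : ℝ) ^ α⌋₊
  simp only at hx hy h hlt
  subst hx hy
  have hn' : (0 : ℝ) < n := by exact_mod_cast hn
  refine ⟨n, ?_, m, by simpa only [Int.cast_natCast] using hne n m hn h, ?_⟩
  · by_contra hnN
    refine absurd hlt (not_lt.2 (Nat.floor_mono (Real.rpow_le_rpow hn'.le ?_ (by linarith))))
    exact_mod_cast (not_le.1 hnN).le
  have hfl : ∀ k : ℕ, (⌊(k : ℝ) ^ α⌋₊ : ℝ) ≤ (k : ℝ) ^ α ∧ (k : ℝ) ^ α < ⌊(k : ℝ) ^ α⌋₊ + 1 :=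
    fun k => ⟨Nat.floor_le (by positivity), Nat.lt_floor_add_one _⟩
  have hv : (θ * n) ^ α = a * (n : ℝ) ^ α := by rw [Real.mul_rpow hθ0.le hn'.le, hθα]
  have hclose : |(m : ℝ) ^ α - (θ * n) ^ α| ≤ a + 1 + |b| := by
    rw [hv, abs_le]
    obtain ⟨h1, h2⟩ := hfl n
    obtain ⟨h3, h4⟩ := hfl m
    have := abs_le.1 (le_refl |b|)
    constructor <;> nlinarith
  have key := (abs_sub_mul_rpow_le (Nat.cast_nonneg m) (mul_pos hθ0 hn') hα.le).trans hclose
  have hpow : (n : ℝ) ^ α = n * (n : ℝ) ^ (α - 1) := by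
    rw [Real.rpow_sub_one hn'.ne']; field_simp
  have hdiv : |θ - (m : ℝ) / n| = |(m : ℝ) - θ * n| / n := by
    rw [← abs_of_pos hn', ← abs_div, abs_of_pos hn', ← abs_neg]
    congr 1; field_simp; ring
  have hT : 0 < θ ^ (α - 1) := Real.rpow_pos_of_pos hθ0 _
  have hP : 0 < (n : ℝ) ^ (α - 1) := Real.rpow_pos_of_pos hn' _
  rw [Real.mul_rpow hθ0.le hn'.le] at key
  rw [Int.cast_natCast, hdiv, hpow, lt_div_iff₀ (by positivity)]
  calc |(m : ℝ) - θ * n| / n * (n * (n : ℝ) ^ (α - 1))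
      = |(m : ℝ) - θ * n| * (θ ^ (α - 1) * (n : ℝ) ^ (α - 1)) / θ ^ (α - 1) := by field_simp
    _ ≤ (a + 1 + |b|) / θ ^ (α - 1) := by gcongr
    _ < _ := by rw [add_div]; linarith

/-- The map `α ↦ a ^ α⁻¹` pulls null sets back to null sets, because its inverse
`θ ↦ log a / log θ` is differentiable. -/
theorem ae_rpow_inv_notMem {a : ℝ} (ha : 0 < a) (ha1 : a ≠ 1) {Z : Set ℝ} (hZ : volume Z = 0) :
    ∀ᵐ α : ℝ, α ≠ 0 → a ^ α⁻¹ ∉ Z := by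
  have hlog : Real.log a ≠ 0 := Real.log_ne_zero_of_pos_of_ne_one ha ha1
  have himg : volume ((fun θ => Real.log a / Real.log θ) '' (Z ∩ {θ | Real.log θ ≠ 0})) = 0 := by
    refine addHaar_image_eq_zero_of_differentiableOn_of_addHaar_eq_zero volume ?_
      (measure_mono_null Set.inter_subset_left hZ)
    rintro θ ⟨-, hθ⟩
    have hθ0 : θ ≠ 0 := by rintro rfl; exact hθ Real.log_zero
    exact ((differentiableAt_const _).div (Real.differentiableAt_log hθ0) hθ).differentiableWithinAt
  refine measure_mono_null (fun α hα => ?_) himg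
  obtain ⟨hα0, hα⟩ : α ≠ 0 ∧ a ^ α⁻¹ ∈ Z := by
    by_contra h
    exact hα fun h0 hz => h ⟨h0, hz⟩
  refine ⟨a ^ α⁻¹, ⟨hα, ?_⟩, ?_⟩
  · show Real.log (a ^ α⁻¹) ≠ 0
    rw [Real.log_rpow ha]
    exact mul_ne_zero (inv_ne_zero hα0) hlog
  · show Real.log a / Real.log (a ^ α⁻¹) = α
    rw [Real.log_rpow ha]
    field_simp

theorem ae_not_solvableIn_PS {a b : ℝ} (ha : 0 < a) (hab : (a, b) ≠ (1, 0)) :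
    ∀ᵐ α : ℝ, 2 < α → ¬ SolvableIn a b (PS α) := by
  by_cases ha1 : a = 1
  -- For `a = 1` the map `α ↦ a ^ α⁻¹` is constant, so a null-set argument is useless; but `m = n`
  -- would force `b = 0`, and rational numbers are not `LiouvilleWith p` for any `p > 1`.
  · subst ha1
    refine Eventually.of_forall fun α hα hS => ?_
    have hirr := (liouvilleWith_of_solvableIn_PS one_pos (by linarith) hS ?_).irrational
      (by linarith)
    · rw [Real.one_rpow] at hirr
      exact not_irrational_one hirr
    · intro n m hn h heq
      rw [Real.one_rpow, eq_comm, div_eq_one_iff_eq (by exact_mod_cast hn.ne')] at heq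
      rw [heq] at h
      exact hab (by rw [Prod.mk.injEq]; exact ⟨rfl, by linarith⟩)
  · have hZ : volume ({x : ℝ | ¬ ∀ p > (2 : ℝ), ¬ LiouvilleWith p x} ∪
        Set.range ((↑) : ℚ → ℝ)) = 0 :=
      measure_union_null (ae_iff.1 ae_not_liouvilleWith)
        ((Set.countable_range _).measure_zero _)
    filter_upwards [ae_rpow_inv_notMem ha ha1 hZ] with α hα hα2 hS
    have hmem := hα (by linarith)
    rw [Set.mem_union, not_or] at hmem
    refine not_not.1 hmem.1 α hα2 (liouvilleWith_of_solvableIn_PS ha (by linarith) hS ?_)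
    intro n m _ _ heq
    exact hmem.2 ⟨(m : ℚ) / n, by rw [heq]; push_cast; rfl⟩

/-! ### Solvability for exponents below two -/

/-- If `X` lies in `[x + s₁, x + s₂]` with `b < a * s₁` and `a * s₂ < b + 1`, then `a * X` lies in the
interior of `[y, y + 1]` for `y = a * x + b`, so every `Y` near `a * X` has integer part `y`. -/
theorem floor_eq_of_abs_sub_lt {a b s₁ s₂ ε X Y : ℝ} (ha : 0 < a) (hs₁ : 0 ≤ s₁) (hs₂ : s₂ < 1)
    (hε₁ : ε ≤ a * s₁ - b) (hε₂ : ε ≤ b + 1 - a * s₂) {x y : ℕ} (hxy : (y : ℝ) = a * x + b)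
    (hX₁ : x + s₁ ≤ X) (hX₂ : X ≤ x + s₂) (hY : |Y - a * X| < ε) :
    x = ⌊X⌋₊ ∧ y = ⌊Y⌋₊ := by
  obtain ⟨h1, h2⟩ := abs_lt.1 hY
  have hx0 : (0 : ℝ) ≤ x := by positivity
  have hy0 : (0 : ℝ) ≤ y := by positivity
  have h3 : a * (x + s₁) ≤ a * X := by gcongr
  have h4 : a * X ≤ a * (x + s₂) := by gcongr
  exact ⟨((Nat.floor_eq_iff (by linarith)).2 ⟨by linarith, by linarith⟩).symm,
    ((Nat.floor_eq_iff (by linarith)).2 ⟨by linarith, by linarith⟩).symm⟩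

theorem tendsto_rpow_sub_two_add_div_log {α : ℝ} (hα : α < 2) (c : ℝ) :
    Tendsto (fun n : ℕ => (n : ℝ) ^ α / (n : ℝ) ^ 2 + c / Real.log n) atTop (𝓝 0) := by
  have h1 : Tendsto (fun n : ℕ => (n : ℝ) ^ α / (n : ℝ) ^ 2) atTop (𝓝 0) := by
    refine ((tendsto_rpow_neg_atTop (by linarith : 0 < 2 - α)).comp
      tendsto_natCast_atTop_atTop).congr' ?_
    filter_upwards [eventually_gt_atTop 0] with n hn
    have hn' : (0 : ℝ) < n := by exact_mod_cast hn
    rw [Function.comp_apply, ← Real.rpow_natCast (n : ℝ) 2, ← Real.rpow_sub hn']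
    congr 1; push_cast; ring
  have h2 : Tendsto (fun n : ℕ => c / Real.log n) atTop (𝓝 0) :=
    Tendsto.const_div_atTop (Real.tendsto_log_atTop.comp tendsto_natCast_atTop_atTop) _
  simpa using h1.add h2

/-- The function `(r, α) ↦ r ^ α` takes the value `a` at `(a ^ α₀⁻¹, α₀)` and is differentiable there. -/
theorem exists_mul_rpow_approx {a α₀ : ℝ} (ha : 0 < a) (hα₀ : α₀ ≠ 0) :
    ∃ C > 0, ∃ η > 0, ∀ r α t : ℝ, |a ^ α₀⁻¹ - r| ≤ t → |α - α₀| ≤ t → t < η →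
      0 < r ∧ |r ^ α - a| ≤ C * t := by
  set θ := a ^ α₀⁻¹ with hθ
  have hθ0 : 0 < θ := Real.rpow_pos_of_pos ha _
  have hθα : θ ^ α₀ = a := by
    rw [hθ, ← Real.rpow_mul ha.le, inv_mul_cancel₀ hα₀, Real.rpow_one]
  obtain ⟨C, hC, hO⟩ := ((Real.hasStrictFDerivAt_rpow_of_pos (θ, α₀) hθ0).hasFDerivAt
    |>.differentiableAt.isBigO_sub).exists_pos
  rw [Asymptotics.IsBigOWith, Metric.eventually_nhds_iff] at hO
  obtain ⟨η, hη, hO⟩ := hO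
  refine ⟨C, hC, min η θ, lt_min hη hθ0, fun r α t hr hα ht => ?_⟩
  obtain ⟨ht1, ht2⟩ := lt_min_iff.1 ht
  have hnorm : ‖((r, α) : ℝ × ℝ) - (θ, α₀)‖ ≤ t := by
    rw [Prod.mk_sub_mk, Prod.norm_mk, Real.norm_eq_abs, Real.norm_eq_abs, abs_sub_comm r]
    exact max_le hr hα
  have := hO (y := (r, α)) (by rw [dist_eq_norm]; linarith)
  refine ⟨by linarith [(abs_le.1 hr).2], ?_⟩
  simp only [hθα, Real.norm_eq_abs] at this
  exact this.trans (by gcongr)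

/-- The exponents `α` with `ν ^ α ∈ [x + s₁, x + s₂]` form an interval. If `x` exceeds `ν ^ α₀` by a
bounded amount, then both the length of this interval and its distance from `α₀` are of order
`1 / (ν ^ α₀ * log ν)`; hence a dilation by a factor independent of `ν` and `x` makes it reach
`α₀`. -/
theorem exists_closedBall_forall_rpow_mem_Icc {ν α₀ x s₁ s₂ c : ℝ} (hν : 1 < ν) (hα₀ : 0 ≤ α₀)
    (hs₁ : 0 ≤ s₁) (hs : s₁ < s₂) (hc : 0 < c) (hx : ν ^ α₀ ≤ x) (hx' : x + s₂ ≤ ν ^ α₀ + c) :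
    ∃ w δ : ℝ, 0 < δ ∧ δ ≤ c / (ν ^ α₀ * Real.log ν) ∧
      α₀ ∈ Metric.closedBall w (2 * c * (c + 1) / (s₂ - s₁) * δ) ∧
      ∀ α ∈ Metric.closedBall w δ, ν ^ α ∈ Set.Icc (x + s₁) (x + s₂) ∧
        |α - α₀| ≤ c / (ν ^ α₀ * Real.log ν) := by
  have hν0 : 0 < ν := by linarith
  have hu1 : 1 ≤ ν ^ α₀ := Real.one_le_rpow hν.le hα₀
  have hlogu : Real.log (ν ^ α₀) = α₀ * Real.log ν := Real.log_rpow hν0 _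
  have hpow : ∀ α, ν ^ α = Real.exp (α * Real.log ν) := fun α => by
    rw [Real.rpow_def_of_pos hν0, mul_comm]
  have hL : 0 < Real.log ν := Real.log_pos hν
  generalize ν ^ α₀ = u at *
  generalize Real.log ν = L at *
  have hxs₁ : 0 < x + s₁ := by linarith
  have hxs₂ : 0 < x + s₂ := by linarith
  have hs' := sub_pos.2 hs
  obtain ⟨α₁, hα₁⟩ : ∃ α₁, α₁ = Real.log (x + s₁) / L := ⟨_, rfl⟩
  obtain ⟨α₂, hα₂⟩ : ∃ α₂, α₂ = Real.log (x + s₂) / L := ⟨_, rfl⟩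
  have hα₀₁ : α₀ ≤ α₁ := by
    rw [hα₁, le_div_iff₀ hL, ← hlogu]
    exact Real.log_le_log (by linarith) (by linarith)
  have hα₂₀ : α₂ - α₀ ≤ c / (u * L) := by
    have h3 : Real.log (x + s₂) - Real.log u ≤ c / u := by
      rw [← Real.log_div hxs₂.ne' (by linarith)]
      refine (Real.log_le_sub_one_of_pos (by positivity)).trans ?_
      rw [div_sub_one (by linarith)]
      gcongr
      linarith
    have h4 : α₂ - α₀ = (Real.log (x + s₂) - Real.log u) / L := by
      rw [hlogu, hα₂]; field_simp
    rw [h4, ← div_div]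
    gcongr
  have hα₁₂ : (s₂ - s₁) / ((c + 1) * (u * L)) ≤ α₂ - α₁ := by
    have h3 : (s₂ - s₁) / ((c + 1) * u) ≤ Real.log (x + s₂) - Real.log (x + s₁) := by
      rw [← Real.log_div hxs₂.ne' hxs₁.ne']
      refine le_trans ?_ (Real.one_sub_inv_le_log_of_pos (by positivity))
      rw [inv_div, one_sub_div hxs₂.ne', add_sub_add_left_eq_sub]
      exact div_le_div_of_nonneg_left hs'.le hxs₂ (by nlinarith)
    rw [hα₂, hα₁, ← sub_div, ← mul_assoc, ← div_div]
    gcongr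
  have hgap : 0 < α₂ - α₁ := lt_of_lt_of_le (by positivity) hα₁₂
  refine ⟨(α₁ + α₂) / 2, (α₂ - α₁) / 2, by linarith, by linarith, ?_, fun α hα => ?_⟩
  · rw [Metric.mem_closedBall, Real.dist_eq, abs_of_nonpos (by linarith)]
    have h3 : 2 * c * (c + 1) / (s₂ - s₁) * ((s₂ - s₁) / ((c + 1) * (u * L)) / 2) =
        c / (u * L) := by
      field_simp
    calc -(α₀ - (α₁ + α₂) / 2) ≤ c / (u * L) := by linarith
      _ = 2 * c * (c + 1) / (s₂ - s₁) * ((s₂ - s₁) / ((c + 1) * (u * L)) / 2) := h3.symm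
      _ ≤ _ := by gcongr
  · rw [Metric.mem_closedBall, Real.dist_eq, abs_le] at hα
    have hα1 : α₁ ≤ α := by linarith [hα.1]
    have hα2 : α ≤ α₂ := by linarith [hα.2]
    refine ⟨⟨?_, ?_⟩, by rw [abs_of_nonneg] <;> linarith⟩
    · rw [hpow, ← Real.log_le_iff_le_exp hxs₁]
      rwa [hα₁, div_le_iff₀ hL] at hα1
    · rw [hpow, ← Real.le_log_iff_exp_le hxs₂]
      rwa [hα₂, le_div_iff₀ hL] at hα2

/-- Near every `α₀ ∈ (1, 2)` there are arbitrarily short intervals of exponents, at a distance from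
`α₀` comparable with their length, throughout which one and the same pair `(x, y)`, with `x`
arbitrarily large, is a solution in `PS α`.

The pair comes from a Dirichlet approximation `m / n` of `θ = a ^ α₀⁻¹`. When
`|α - α₀| = O(1 / (n ^ α₀ * log n))`, the difference `m ^ α - a * n ^ α` is
`O(n ^ (α₀ - 2) + 1 / log n)`, hence small because `α₀ < 2`; yet over such a range of `α` the value
`n ^ α` moves by a constant amount, enough to bring it to a prescribed position relative to the
progression `x₀ + q * t`. -/
theorem exists_closedBall_forall_solution {a b α₀ : ℝ} (hb : 0 ≤ b) (hba : b < a)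
    (h1 : 1 < α₀) (h2 : α₀ < 2) {x₀ q : ℕ} (hq : 0 < q)
    (hprog : ∀ t : ℕ, ∃ y : ℕ, (y : ℝ) = a * ((x₀ + q * t : ℕ) : ℝ) + b) :
    ∃ K : ℝ, ∀ ρ > 0, ∀ k : ℕ, ∃ w δ : ℝ, 0 < δ ∧ δ < ρ ∧ α₀ ∈ Metric.closedBall w (K * δ) ∧
      ∀ α ∈ Metric.closedBall w δ, ∃ x ∈ PS α, k ≤ x ∧ ∃ y ∈ PS α, (y : ℝ) = a * x + b := by
  have ha : 0 < a := hb.trans_lt hba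
  -- As `b < a`, there is room below `1` for an interval `[s₁, s₂]` of fractional parts of `n ^ α`
  -- for which `m ^ α ≈ a * n ^ α` gives `⌊m ^ α⌋ = a * ⌊n ^ α⌋ + b`.
  obtain ⟨s₁, hs₁, hs₁'⟩ := exists_between
    (show b / a < min 1 ((b + 1) / a) from lt_min ((div_lt_one ha).2 hba) (by gcongr; linarith))
  obtain ⟨s₂, hs₂, hs₂'⟩ := exists_between hs₁'
  obtain ⟨hs₂1, hs₂b⟩ := lt_min_iff.1 hs₂'
  rw [lt_div_iff₀ ha] at hs₂b
  have hs₁0 : 0 ≤ s₁ := (div_nonneg hb ha.le).trans hs₁.le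
  rw [div_lt_iff₀ ha] at hs₁
  obtain ⟨ε, hε, hεlt⟩ := exists_between
    (show 0 < min (a * s₁ - b) (b + 1 - a * s₂) from lt_min (by linarith) (by linarith))
  obtain ⟨hε₁, hε₂⟩ := lt_min_iff.1 hεlt
  obtain ⟨C, hC, η, hη, happrox⟩ := exists_mul_rpow_approx ha (by linarith : α₀ ≠ 0)
  set c : ℝ := q + 1
  have hc0 : 0 < c := by positivity
  refine ⟨2 * c * (c + 1) / (s₂ - s₁), fun ρ hρ k => ?_⟩
  have hT := tendsto_rpow_sub_two_add_div_log h2 c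
  have hT' : Tendsto (fun n : ℕ => (c + 1) * C * ((n : ℝ) ^ α₀ / (n : ℝ) ^ 2 + c / Real.log n))
      atTop (𝓝 0) := by simpa using hT.const_mul ((c + 1) * C)
  have hu_lim : Tendsto (fun n : ℕ => (n : ℝ) ^ α₀) atTop atTop :=
    (tendsto_rpow_atTop (by linarith)).comp tendsto_natCast_atTop_atTop
  obtain ⟨N, hN⟩ := eventually_atTop.1 ((hT.eventually_lt_const hη).and
    ((hT.eventually_lt_const hρ).and ((hT'.eventually_lt_const hε).and
      ((hu_lim.eventually_ge_atTop ((x₀ : ℝ) + k)).and (eventually_ge_atTop 2)))))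
  obtain ⟨n, hnN, m, hm⟩ := exists_ge_abs_sub_div_le (a ^ α₀⁻¹) N
  obtain ⟨hTη, hTρ, hTε, hux₀, hn2⟩ := hN n hnN
  have hn : (1 : ℝ) < n := by exact_mod_cast hn2
  have hn0 : (0 : ℝ) < n := by linarith
  set u : ℝ := (n : ℝ) ^ α₀
  have hu1 : 1 ≤ u := Real.one_le_rpow hn.le (by linarith)
  have hlog : 0 < Real.log n := Real.log_pos hn
  set L := Real.log n
  have hq' : (0 : ℝ) < q := by exact_mod_cast hq
  -- `t` picks the first term of the progression that is at least `n ^ α₀`.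
  obtain ⟨t, ht⟩ : ∃ t : ℕ, t = ⌈(u - x₀) / q⌉₊ := ⟨_, rfl⟩
  obtain ⟨y, hy⟩ := hprog t
  have hk0 : (0 : ℝ) ≤ k := by positivity
  have hxu : u ≤ ((x₀ + q * t : ℕ) : ℝ) := by
    have := Nat.le_ceil ((u - x₀) / q)
    rw [← ht, div_le_iff₀ hq'] at this
    push_cast; linarith
  have hxu' : ((x₀ + q * t : ℕ) : ℝ) ≤ u + q := by
    have := Nat.ceil_lt_add_one (div_nonneg (by linarith : 0 ≤ u - x₀) hq'.le)
    rw [← ht, ← sub_lt_iff_lt_add, lt_div_iff₀ hq'] at this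
    push_cast; linarith
  generalize x₀ + q * t = x at hy hxu hxu'
  obtain ⟨w, δ, hδ0, hδ, hmem, hball⟩ := exists_closedBall_forall_rpow_mem_Icc (x := x) hn
    (by linarith : 0 ≤ α₀) hs₁0 hs₂ hc0 hxu (by linarith)
  have hD : c / (u * L) ≤ (u / (n : ℝ) ^ 2 + c / L) / u := by
    have h3 : c / (u * L) = c / L / u := by rw [div_div, mul_comm]
    rw [h3, add_div (u / _)]
    have : 0 ≤ u / (n : ℝ) ^ 2 / u := by positivity
    linarith
  set T := u / (n : ℝ) ^ 2 + c / L with hTdef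
  have hT0 : 0 < T := by positivity
  have hTu : T / u ≤ T := div_le_self hT0.le hu1
  refine ⟨w, δ, hδ0, by linarith, hmem, fun α hα => ?_⟩
  obtain ⟨⟨hX₁, hX₂⟩, hαα₀⟩ := hball α hα
  have hr : |a ^ α₀⁻¹ - (m : ℝ) / n| ≤ T / u := by
    refine hm.trans ?_
    rw [hTdef, add_div, div_right_comm, div_self (zero_lt_one.trans_le hu1).ne']
    have : 0 ≤ c / L / u := by positivity
    linarith
  obtain ⟨hr0, hra⟩ := happrox _ α _ hr (hαα₀.trans hD) (hTu.trans_lt hTη)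
  have hm0 : 0 < m := by
    have : (0 : ℝ) < m := by simpa [hn0] using (mul_pos hr0 hn0)
    exact_mod_cast this
  lift m to ℕ using hm0.le
  have hY : |(m : ℝ) ^ α - a * (n : ℝ) ^ α| < ε := by
    have h3 : (m : ℝ) ^ α - a * (n : ℝ) ^ α = (n : ℝ) ^ α * (((m : ℝ) / n) ^ α - a) := by
      rw [Real.div_rpow (by positivity) hn0.le]
      have := Real.rpow_pos_of_pos hn0 α
      field_simp
    have h4 : (n : ℝ) ^ α ≤ (c + 1) * u := by
      have := le_mul_of_one_le_right hc0.le hu1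
      linarith
    rw [h3, abs_mul, abs_of_pos (Real.rpow_pos_of_pos hn0 _)]
    calc (n : ℝ) ^ α * |((m : ℝ) / n) ^ α - a| ≤ (c + 1) * u * (C * (T / u)) := by
          gcongr
          simpa using hra
      _ = (c + 1) * C * T := by field_simp
      _ < ε := hTε
  obtain ⟨hxf, hyf⟩ := floor_eq_of_abs_sub_lt ha hs₁0 hs₂1 hε₁.le hε₂.le hy hX₁ hX₂ hY
  refine ⟨x, ⟨n, by omega, hxf⟩, ?_, y, ⟨m, by exact_mod_cast hm0, hyf⟩, hy⟩
  have : (k : ℝ) ≤ x := by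
    have : (0 : ℝ) ≤ x₀ := by positivity
    linarith
  exact_mod_cast this

/-- A set `S` (measurable or not) is null if near each of its points there are arbitrarily small
balls disjoint from `S`, at a distance from the point comparable with their radius: such a point is
not a Lebesgue density point. -/
theorem ae_notMem_of_forall_exists_closedBall_disjoint {S : Set ℝ}
    (hS : ∀ x ∈ S, ∃ K : ℝ, ∀ ρ > 0, ∃ w δ : ℝ, 0 < δ ∧ δ < ρ ∧
      x ∈ Metric.closedBall w (K * δ) ∧ Disjoint S (Metric.closedBall w δ)) :
    ∀ᵐ x : ℝ, x ∉ S := by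
  have hdens : ∀ᵐ x : ℝ, ∀ K : ℕ, x ∈ S → ∀ (w δ : ℕ → ℝ), Tendsto δ atTop (𝓝[>] 0) →
      (∀ᶠ j in atTop, x ∈ Metric.closedBall (w j) (K * δ j)) →
      Tendsto (fun j => volume (S ∩ Metric.closedBall (w j) (δ j)) /
        volume (Metric.closedBall (w j) (δ j))) atTop (𝓝 1) := by
    -- The density theorem has an exceptional set for each dilation factor `K`, so `K` is restricted
    -- to natural numbers.
    refine ae_all_iff.2 fun K => ae_imp_of_ae_restrict ?_
    filter_upwards [IsUnifLocDoublingMeasure.ae_tendsto_measure_inter_div volume S K]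
      with x hx w δ using hx w δ
  filter_upwards [hdens] with x hx hxS
  obtain ⟨K, hK⟩ := hS x hxS
  obtain ⟨K', hK'⟩ := exists_nat_ge K
  choose w δ hδ0 hδ hxw hdisj using fun j : ℕ =>
    hK (1 / ((j : ℝ) + 1)) (by positivity)
  have hlim : Tendsto δ atTop (𝓝[>] 0) :=
    tendsto_nhdsWithin_iff.2 ⟨squeeze_zero (fun j => (hδ0 j).le) (fun j => (hδ j).le)
      tendsto_one_div_add_atTop_nhds_zero_nat, Eventually.of_forall hδ0⟩
  have hone := hx K' hxS w δ hlim (Eventually.of_forall fun j =>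
    Metric.closedBall_subset_closedBall (mul_le_mul_of_nonneg_right hK' (hδ0 j).le) (hxw j))
  simp only [fun j => (hdisj j).inter_eq, measure_empty, ENNReal.zero_div] at hone
  exact zero_ne_one (tendsto_nhds_unique tendsto_const_nhds hone)

theorem ae_solvableIn_PS {a b : ℝ} (hb : 0 ≤ b) (hba : b < a) {x₀ q : ℕ} (hq : 0 < q)
    (hprog : ∀ t : ℕ, ∃ y : ℕ, (y : ℝ) = a * ((x₀ + q * t : ℕ) : ℝ) + b) :
    ∀ᵐ α : ℝ, 1 < α → α < 2 → SolvableIn a b (PS α) := by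
  have hae : ∀ᵐ α : ℝ, ∀ k : ℕ, α ∉ {α : ℝ | (1 < α ∧ α < 2) ∧
      ¬ ∃ x ∈ PS α, k ≤ x ∧ ∃ y ∈ PS α, (y : ℝ) = a * x + b} := by
    refine ae_all_iff.2 fun k => ae_notMem_of_forall_exists_closedBall_disjoint ?_
    rintro α₀ ⟨⟨h1, h2⟩, -⟩
    obtain ⟨K, hK⟩ := exists_closedBall_forall_solution hb hba h1 h2 hq hprog
    refine ⟨K, fun ρ hρ => ?_⟩
    obtain ⟨w, δ, hδ0, hδ, hmem, hsol⟩ := hK ρ hρ k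
    exact ⟨w, δ, hδ0, hδ, hmem, Set.disjoint_left.2 fun α hα hαB => hα.2 (hsol α hαB)⟩
  filter_upwards [hae] with α hα h1 h2
  refine Set.Infinite.of_image Prod.fst (Set.infinite_of_forall_exists_gt fun k => ?_)
  obtain ⟨x, hx, hkx, y, hy, hxy⟩ : ∃ x ∈ PS α, k + 1 ≤ x ∧ ∃ y ∈ PS α, (y : ℝ) = a * x + b := by
    by_contra h
    exact hα (k + 1) ⟨⟨h1, h2⟩, h⟩
  exact ⟨x, ⟨(x, y), ⟨hx, hy, hxy⟩, rfl⟩, hkx⟩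

/-! ### Both ranges of exponents -/

theorem theorem1 (a b : ℝ) (ha : a ≠ 0) (hab : SolvableIn a b {n : ℕ | 0 < n}) :
    ∀ᵐ α : ℝ ∂(MeasureTheory.volume : MeasureTheory.Measure ℝ), 1 < α →
      ((α < 2 ∧ 0 ≤ b ∧ b < a → SolvableIn a b (PS α)) ∧
        (2 < α ∧ (a, b) ≠ (1, 0) → ¬ SolvableIn a b (PS α))) := by
  obtain ⟨ha0, x₀, q, hq, hprog⟩ := solvableIn_progression ha hab
  have hlt : ∀ᵐ α : ℝ, 0 ≤ b ∧ b < a → 1 < α → α < 2 → SolvableIn a b (PS α) := by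
    by_cases h : 0 ≤ b ∧ b < a
    · filter_upwards [ae_solvableIn_PS h.1 h.2 hq hprog] with α hα _ using hα
    · exact Eventually.of_forall fun α h' => absurd h' h
  have hgt : ∀ᵐ α : ℝ, (a, b) ≠ (1, 0) → 2 < α → ¬ SolvableIn a b (PS α) := by
    by_cases h : (a, b) = (1, 0)
    · exact Eventually.of_forall fun α h' => absurd h h'
    · filter_upwards [ae_not_solvableIn_PS ha0 h] with α hα _ using hα
  filter_upwards [hlt, hgt] with α hα₁ hα₂ h1
  exact ⟨fun h => hα₁ h.2 h1 h.1, fun h => hα₂ h.2 h.1⟩
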